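/- For a finite set $A$ let $A^+$ be the free semigroup (the nonempty words) and $A^*$ the free monoid on $A$; $|u|$ is the length of a word $u$. A subset of a semigroup is \emph{rational} if it is obtained from finite subsets by finitely many unions, products and subsemigroup generations $E\mapsto E^+=\bigcup_{n\ge 1}E^n$. A set of words is a rational language if it is a rational subset of $A^*$, and a set of pairs of words is a rational relation if it is a rational subset of $A^*\times A^*$. Let $S$ be a semigroup. A \emph{quasi-automatic semigroup structure} on $S$ is a tuple $(A,\mu,L,R,(R_a)_{a\in A})$, where $A$ is a finite generating set of $S$, $\mu:A^+\to S$ is the natural semigroup homomorphism (sending each $a\in A$ to itself), $L\subseteq A^+$ is a rational language, and $R,R_a\subseteq A^+\times A^+$ ($a\in A$) are rational relations, such that (1) $\mu(L)=S$; (2) $R=\{(u,v)\in L\times L:\mu(u)=\mu(v)\}$; (3) for each $a\in A$, $R_a=\{(u,v)\in L\times L:\mu(ua)=\mu(v)\}$. \textbf{Theorem (computing representatives).} Let $(A,\mu,L,R,(R_a)_{a\in A})$ be a quasi-automatic semigroup structure on a semigroup $S$. There is a function $l:A^+\to L$ such that for every word $u\in A^+$ and every letter $a\in A$ one has $\mu(l(u))=\mu(u)$,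 $\mu(l(u)a)=\mu(l(ua))$ and $(l(u),l(ua))\in R_a$. Moreover, there is an integer $N>1$ with $|l(u)|\le N^{|u|}$ for all $u\in A^+$, and $l(u)$ can be computed from $u$ in time exponential in $|u|$: there are a multi-stack (equivalently, multi-tape) deterministic Turing machine and constants $C,K$ such that on every input $u\in A^+$ the machine outputs $l(u)$ after at most $C\,K^{|u|}$ steps. -/

import Mathlib

/-- The rational subsets of a semigroup: the smallest family of subsets that contains the finite
subsets and is closed under union, product and subsemigroup generation `E⁺ = ⋃ n ≥ 1, Eⁿ`. -/
inductive IsRationalSubset {S : Type*} [Semigroup S] : Set S → Prop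
  | finite {E : Set S} : E.Finite → IsRationalSubset E
  | union {E F : Set S} : IsRationalSubset E → IsRationalSubset F → IsRationalSubset (E ∪ F)
  | mul {E F : Set S} : IsRationalSubset E → IsRationalSubset F →
      IsRationalSubset (Set.image2 (fun x y => x * y) E F)
  | plus {E : Set S} : IsRationalSubset E → IsRationalSubset (Subsemigroup.closure E : Set S)

/-- A language of nonempty words is rational if it is a rational subset of the free monoid. -/
def IsRationalLanguage {A : Type*} (L : Set (FreeSemigroup A)) : Prop :=
  IsRationalSubset (FreeSemigroup.toFreeMonoid '' L)

/-- A relation between nonempty words is rational if it is a rational subset of the direct product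
of the two free monoids. -/
def IsRationalRelation {A B : Type*} (R : Set (FreeSemigroup A × FreeSemigroup B)) : Prop :=
  IsRationalSubset (Prod.map FreeSemigroup.toFreeMonoid FreeSemigroup.toFreeMonoid '' R)

/-- The natural homomorphism from the free semigroup on a subset `A` of a semigroup `S` to `S`;
it sends each letter to itself. -/
def naturalHom {S : Type*} [Semigroup S] (A : Set S) : FreeSemigroup A →ₙ* S :=
  FreeSemigroup.lift Subtype.val

/-- A quasi-automatic semigroup structure `(A, μ, L, R, (R_a)_{a ∈ A})` on `S`, where `μ` is
`naturalHom A`. -/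
structure QuasiAutomaticSemigroupStructure (S : Type*) [Semigroup S] where
  A : Set S
  finite_A : A.Finite
  closure_A : Subsemigroup.closure A = ⊤
  L : Set (FreeSemigroup A)
  R : Set (FreeSemigroup A × FreeSemigroup A)
  Ra : A → Set (FreeSemigroup A × FreeSemigroup A)
  rational_L : IsRationalLanguage L
  rational_R : IsRationalRelation R
  rational_Ra : ∀ a, IsRationalRelation (Ra a)
  image_L : naturalHom A '' L = Set.univ
  R_eq : R = {p | p.1 ∈ L ∧ p.2 ∈ L ∧ naturalHom A p.1 = naturalHom A p.2}
  Ra_eq : ∀ a, Ra a = {p | p.1 ∈ L ∧ p.2 ∈ L ∧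
    naturalHom A (p.1 * FreeSemigroup.of a) = naturalHom A p.2}

/-- The word function `f` is computed by a deterministic multi-stack Turing machine (with finite
stack alphabets) that, on every input word `u`, halts with output `f u` after at most `T |u|`
steps. The input and output alphabets are `A` and `B` up to a renaming of the letters; a word is
stored with its first letter on top of the stack. -/
def IsComputableInTime {A B : Type*} (f : FreeSemigroup A → FreeSemigroup B) (T : ℕ → ℕ) : Prop :=
  ∃ (M : Turing.FinTM2) (i : A ≃ M.Γ M.k₀) (o : B ≃ M.Γ M.k₁),
    (∀ k, Finite (M.Γ k)) ∧
    ∀ u : FreeSemigroup A,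
      Nonempty (Turing.TM2OutputsInTime M (u.toFreeMonoid.toList.map i)
        (some ((f u).toFreeMonoid.toList.map o)) (T u.length))

/-- Computability in time at most `C * K ^ n`, where `n` is the length of the input word. -/
def IsComputableInExponentialTime {A B : Type*} (f : FreeSemigroup A → FreeSemigroup B) : Prop :=
  ∃ C K : ℕ, IsComputableInTime f (fun n => C * K ^ n)

/-! Representatives are built letter by letter: `l a` is a chosen word of `L` with value `a`, and `l
(u a)` is the image of `l u` under a fixed function on `L` whose graph lies in `R_a`. Since `μ(L) =
S`, the domain of `R_a` is all of `L`; the point is to choose the image effectively.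

A rational relation lies in a finite residual family (`IsRationalSubset.hasFiniteResiduals`), an
abstract form of the states of a transducer. A left-to-right pass records, at each prefix, the
members whose domain contains it; a right-to-left pass then always has a legal choice and emits a
bounded word per letter (`exists_bimachine`). Each pass thus multiplies the length by at most a
constant, up to an additive constant, so iteration gives exponential length, and the total cost is
bounded like a geometric sum (`Bimachine.exists_runs_foldl`). -/

/-! ### Rational relations have finite residual families -/

/-- A family of relations is a residual family if the words ending with a letter `a` in the domain
of each member `g` can be reached from the domains of members `g'` of the family such that
appending `a` to the first component and some fixed `x` to the second one maps `g'` into `g`. -/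
def IsResidualFamily {A M : Type*} [Monoid M] (G : Set (Set (FreeMonoid A × M))) : Prop :=
  ∀ g ∈ G, ∀ w a v, (w * FreeMonoid.of a, v) ∈ g →
    ∃ g' ∈ G, ∃ x, (∀ p ∈ g', (p.1 * FreeMonoid.of a, p.2 * x) ∈ g) ∧ ∃ y, (w, y) ∈ g'

theorem FreeMonoid.mul_eq_mul_of_iff {A : Type*} {s t w : FreeMonoid A} {a : A} :
    s * t = w * FreeMonoid.of a ↔
      (t = 1 ∧ s = w * FreeMonoid.of a) ∨ ∃ t', t = t' * FreeMonoid.of a ∧ w = s * t' := by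
  constructor
  · intro h
    have h' : s.toList ++ t.toList = w.toList ++ [a] := congrArg FreeMonoid.toList h
    rcases List.eq_nil_or_concat t.toList with ht | ⟨t', b, ht⟩
    · left
      have ht' : t = 1 := ht
      exact ⟨ht', by simpa [ht'] using h⟩
    · right
      rw [ht, List.concat_eq_append, ← List.append_assoc] at h'
      obtain ⟨h1, h2⟩ := List.append_inj' h' rfl
      obtain rfl : b = a := by simpa using h2
      exact ⟨FreeMonoid.ofList t', ht.trans (List.concat_eq_append ..), h1.symm⟩
  · rintro (⟨rfl, rfl⟩ | ⟨t', rfl, rfl⟩)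
    · simp
    · rw [mul_assoc]

section Residual

open scoped Pointwise

variable {A M : Type*} [Monoid M]

theorem IsResidualFamily.union {G H : Set (Set (FreeMonoid A × M))} (hG : IsResidualFamily G)
    (hH : IsResidualFamily H) : IsResidualFamily (G ∪ H) := by
  rintro g (hg | hg) w a v h
  · obtain ⟨g', h', r⟩ := hG g hg w a v h
    exact ⟨g', .inl h', r⟩
  · obtain ⟨g', h', r⟩ := hH g hg w a v h
    exact ⟨g', .inr h', r⟩

theorem IsResidualFamily.iUnion {ι : Type*} {G : ι → Set (Set (FreeMonoid A × M))}
    (hG : ∀ i, IsResidualFamily (G i)) : IsResidualFamily (⋃ i, G i) := by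
  intro g hg w a v h
  obtain ⟨i, hi⟩ := Set.mem_iUnion.1 hg
  obtain ⟨g', h', r⟩ := hG i g hi w a v h
  exact ⟨g', Set.mem_iUnion.2 ⟨i, h'⟩, r⟩

/-- A relation that belongs to a finite residual family. -/
def HasFiniteResiduals (T : Set (FreeMonoid A × M)) : Prop :=
  ∃ G : Set (Set (FreeMonoid A × M)), G.Finite ∧ T ∈ G ∧ IsResidualFamily G

theorem HasFiniteResiduals.empty : HasFiniteResiduals (∅ : Set (FreeMonoid A × M)) :=
  ⟨{∅}, Set.finite_singleton _, rfl, by rintro g rfl w a v h; exact h.elim⟩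

theorem HasFiniteResiduals.union {T U : Set (FreeMonoid A × M)} (hT : HasFiniteResiduals T)
    (hU : HasFiniteResiduals U) : HasFiniteResiduals (T ∪ U) := by
  obtain ⟨G, hGf, hTG, hG⟩ := hT
  obtain ⟨H, hHf, hUH, hH⟩ := hU
  refine ⟨insert (T ∪ U) (G ∪ H), (hGf.union hHf).insert _, Set.mem_insert _ _, ?_⟩
  rintro g (rfl | hg) w a v h
  · rcases h with h | h
    · obtain ⟨g', h', x, hx, hy⟩ := hG T hTG w a v h
      exact ⟨g', .inr (.inl h'), x, fun p hp => .inl (hx p hp), hy⟩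
    · obtain ⟨g', h', x, hx, hy⟩ := hH U hUH w a v h
      exact ⟨g', .inr (.inr h'), x, fun p hp => .inr (hx p hp), hy⟩
  · obtain ⟨g', h', r⟩ := hG.union hH g hg w a v h
    exact ⟨g', .inr h', r⟩

/-- The family consists of the prefixes of the word, each paired with the same second component, so
that every appended `x` is `1`. -/
theorem HasFiniteResiduals.singleton (p : FreeMonoid A × M) :
    HasFiniteResiduals ({p} : Set (FreeMonoid A × M)) := by
  obtain ⟨w, v⟩ := p
  obtain ⟨l, rfl⟩ : ∃ l : List A, FreeMonoid.ofList l = w := ⟨w.toList, rfl⟩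
  induction l using List.reverseRecOn with
  | nil =>
    refine ⟨{{(1, v)}}, Set.finite_singleton _, rfl, ?_⟩
    rintro g rfl w a y h
    have h1 : w.toList ++ [a] = [] := congrArg FreeMonoid.toList (congrArg Prod.fst h)
    simp at h1
  | append_singleton l b ih =>
    obtain ⟨G, hGf, hTG, hG⟩ := ih
    refine ⟨insert _ G, hGf.insert _, Set.mem_insert _ _, ?_⟩
    rintro g (rfl | hg) w a y h
    · have h1 : w.toList ++ [a] = l ++ [b] := congrArg FreeMonoid.toList (congrArg Prod.fst h)
      obtain ⟨h2, h3⟩ := List.append_inj' h1 rfl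
      obtain rfl : a = b := by simpa using h3
      obtain rfl : w = FreeMonoid.ofList l := h2
      refine ⟨_, .inr hTG, 1, ?_, v, rfl⟩
      rintro p rfl
      exact Prod.ext rfl (mul_one v)
    · obtain ⟨g', h', r⟩ := hG g hg w a y h
      exact ⟨g', .inr h', r⟩

/-- The family is `G ∪ T·H`. If the factor from `U` has trivial first component, the last letter
comes from `T`, and the leftover `t'` is absorbed into `x`; this is why `x` may be any element of
`M`. -/
theorem HasFiniteResiduals.mul {T U : Set (FreeMonoid A × M)} (hT : HasFiniteResiduals T)
    (hU : HasFiniteResiduals U) : HasFiniteResiduals (T * U) := by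
  obtain ⟨G, hGf, hTG, hG⟩ := hT
  obtain ⟨H, hHf, hUH, hH⟩ := hU
  refine ⟨G ∪ (T * ·) '' H, hGf.union (hHf.image _), .inr ⟨U, hUH, rfl⟩, ?_⟩
  rintro g (hg | ⟨g, hg, rfl⟩) w a v h
  · obtain ⟨g', h', r⟩ := hG g hg w a v h
    exact ⟨g', .inl h', r⟩
  · obtain ⟨⟨s, s'⟩, hs, ⟨t, t'⟩, ht, hst⟩ := h
    obtain ⟨h1, -⟩ := Prod.mk.inj hst
    rcases FreeMonoid.mul_eq_mul_of_iff.1 h1 with ⟨rfl, rfl⟩ | ⟨t, rfl, rfl⟩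
    · obtain ⟨g', h', x, hx, hy⟩ := hG T hTG w a _ hs
      refine ⟨g', .inl h', x * t', fun p hp => ⟨_, hx p hp, _, ht, ?_⟩, hy⟩
      simp [mul_assoc]
    · obtain ⟨g', h', x, hx, y, hy⟩ := hH g hg t a _ ht
      refine ⟨_, .inr ⟨g', h', rfl⟩, x, ?_, _, ⟨_, hs, _, hy, rfl⟩⟩
      rintro _ ⟨p, hp, q, hq, rfl⟩
      exact ⟨p, hp, _, hx q hq, Prod.ext (mul_assoc ..).symm (by simp [mul_assoc])⟩

/-- Trailing factors with trivial first component are discarded. The value `v` is lost, which is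
harmless: a residual family only has to keep `w` in a domain. -/
theorem exists_mem_of_mem_submonoidClosure {T : Set (FreeMonoid A × M)} {w : FreeMonoid A} {a : A}
    {v : M} (h : (w * FreeMonoid.of a, v) ∈ Submonoid.closure T) :
    ∃ s t x y, w = s * t ∧ (s, x) ∈ Submonoid.closure T ∧ (t * FreeMonoid.of a, y) ∈ T := by
  generalize hz : (w * FreeMonoid.of a, v) = z at h
  induction h using Submonoid.closure_induction_right generalizing v with
  | one =>
    have h1 : w.toList ++ [a] = [] := congrArg FreeMonoid.toList (congrArg Prod.fst hz)
    simp at h1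
  | mul_right p hp q hq ih =>
    obtain ⟨s, x⟩ := p
    obtain ⟨t, y⟩ := q
    obtain ⟨h1, -⟩ := Prod.mk.inj hz
    rcases FreeMonoid.mul_eq_mul_of_iff.1 h1.symm with ⟨rfl, rfl⟩ | ⟨t, rfl, rfl⟩
    · exact ih rfl
    · exact ⟨s, t, x, y, rfl, hp, hq⟩

theorem coe_subsemigroupClosure_eq {M : Type*} [Monoid M] (T : Set M) :
    (Subsemigroup.closure T : Set M) = (Submonoid.closure T : Set M) * T := by
  ext z
  constructor
  · intro h
    induction h using Subsemigroup.closure_induction with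
    | mem x hx => exact ⟨1, one_mem _, x, hx, one_mul x⟩
    | mul x y _ _ hx hy =>
      obtain ⟨p, hp, q, hq, rfl⟩ := hx
      obtain ⟨r, hr, s, hs, rfl⟩ := hy
      exact ⟨p * q * r, mul_mem (mul_mem hp (Submonoid.subset_closure hq)) hr, s, hs,
        by simp [mul_assoc]⟩
  · rintro ⟨p, hp, q, hq, rfl⟩
    induction hp using Submonoid.closure_induction_left with
    | one => simpa using Subsemigroup.subset_closure hq
    | mul_left x hx y _ ih =>
      simpa [mul_assoc] using mul_mem (Subsemigroup.subset_closure hx) ih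

/-- The family consists of the products `T*·g`, and contains `T⁺ = T*·T`. When the factor from `g`
contributes no letter, the last letter is sought inside `T*`, and the search restarts in a residual
of `T`. -/
theorem HasFiniteResiduals.plus {T : Set (FreeMonoid A × M)} (hT : HasFiniteResiduals T) :
    HasFiniteResiduals (Subsemigroup.closure T : Set (FreeMonoid A × M)) := by
  obtain ⟨G, hGf, hTG, hG⟩ := hT
  refine ⟨((Submonoid.closure T : Set (FreeMonoid A × M)) * ·) '' G, hGf.image _,
    ⟨T, hTG, (coe_subsemigroupClosure_eq T).symm⟩, ?_⟩
  rintro _ ⟨g, hg, rfl⟩ w a v h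
  obtain ⟨⟨s, s'⟩, hs, ⟨t, t'⟩, ht, hst⟩ := h
  obtain ⟨h1, -⟩ := Prod.mk.inj hst
  rcases FreeMonoid.mul_eq_mul_of_iff.1 h1 with ⟨rfl, rfl⟩ | ⟨t, rfl, rfl⟩
  · obtain ⟨s, t, z, z', rfl, hsz, htz⟩ := exists_mem_of_mem_submonoidClosure hs
    obtain ⟨g', h', x, hx, y, hy⟩ := hG T hTG t a _ htz
    refine ⟨_, ⟨g', h', rfl⟩, x * t', ?_, _, ⟨_, hsz, _, hy, rfl⟩⟩
    rintro _ ⟨p, hp, q, hq, rfl⟩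
    exact ⟨_, mul_mem hp (Submonoid.subset_closure (hx q hq)), _, ht, Prod.ext (by simp [mul_assoc]) (by simp [mul_assoc])⟩
  · obtain ⟨g', h', x, hx, y, hy⟩ := hG g hg t a _ ht
    refine ⟨_, ⟨g', h', rfl⟩, x, ?_, _, ⟨_, hs, _, hy, rfl⟩⟩
    rintro _ ⟨p, hp, q, hq, rfl⟩
    exact ⟨p, hp, _, hx q hq, Prod.ext (mul_assoc ..).symm (by simp [mul_assoc])⟩

theorem IsRationalSubset.hasFiniteResiduals {T : Set (FreeMonoid A × M)}
    (hT : IsRationalSubset T) : HasFiniteResiduals T := by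
  induction hT with
  | @finite E hE =>
    induction E, hE using Set.Finite.induction_on with
    | empty => exact .empty
    | insert _ _ ih => exact (HasFiniteResiduals.singleton _).union ih
  | union _ _ hE hF => exact hE.union hF
  | mul _ _ hE hF => exact hE.mul hF
  | plus _ hE => exact hE.plus

end Residual

/-! ### Two-pass transducers and their output length -/

/-- A two-pass transducer: `next` is a deterministic automaton that reads the input from left to
right, `trans` and `out` read it back from right to left together with the states of `next`. -/
structure Bimachine (A Q D : Type*) where
  start : D
  next : A → D → D
  trans : Q → A → D → Q
  out : Q → A → D → List A
  fin : Q → List A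

namespace Bimachine

variable {A Q D : Type*} (B : Bimachine A Q D)

/-- The first pass, which records the letters and states on a stack. -/
def scan : D → List A → List (A × D) → List (A × D)
  | _, [], X => X
  | d, a :: w, X => scan (B.next a d) w ((a, d) :: X)

/-- The second pass, which pops the letters and states and pushes the output. -/
def unwind : Q → List (A × D) → List A → List A
  | q, [], W => B.fin q ++ W
  | q, (a, d) :: X, W => unwind (B.trans q a d) X (B.out q a d ++ W)

/-- The function computed from the state `q`. -/
def run (q : Q) (w : List A) : List A :=
  B.unwind q (B.scan B.start w []) []

/-- The state of the first pass after a word. -/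
def prefixState (w : List A) : D :=
  w.foldl (fun d a => B.next a d) B.start

/-- The state stored with a letter is the one reached before reading it, so the second pass knows
the prefix that remains to be read. -/
theorem scan_append_singleton (w : List A) (a : A) (d : D) (X : List (A × D)) :
    B.scan d (w ++ [a]) X = (a, w.foldl (fun d a => B.next a d) d) :: B.scan d w X := by
  induction w generalizing d X with
  | nil => rfl
  | cons b w ih => exact ih _ _

theorem length_scan (w : List A) (d : D) (X : List (A × D)) :
    (B.scan d w X).length = w.length + X.length := by
  induction w generalizing d X with
  | nil => simp [scan]
  | cons b w ih => rw [scan, ih]; simp; omega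

/-- All output words of the transducer have length at most `c`. -/
def OutputBound (c : ℕ) : Prop :=
  (∀ q a d, (B.out q a d).length ≤ c) ∧ ∀ q, (B.fin q).length ≤ c

theorem exists_outputBound [Finite A] [Finite Q] [Finite D] : ∃ c, B.OutputBound c := by
  obtain ⟨c, hc⟩ := (Set.finite_range fun p : Q × A × D => (B.out p.1 p.2.1 p.2.2).length).bddAbove
  obtain ⟨c', hc'⟩ := (Set.finite_range fun q => (B.fin q).length).bddAbove
  exact ⟨max c c', fun q a d => (hc ⟨(q, a, d), rfl⟩).trans (le_max_left _ _),
    fun q => (hc' ⟨q, rfl⟩).trans (le_max_right _ _)⟩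

theorem length_unwind_le {B : Bimachine A Q D} {c : ℕ} (hc : B.OutputBound c) (q : Q)
    (X : List (A × D)) (W : List A) :
    (B.unwind q X W).length ≤ c * (X.length + 1) + W.length := by
  induction X generalizing q W with
  | nil => simpa [unwind] using hc.2 q
  | cons p X ih =>
    have h1 := ih (B.trans q p.1 p.2) (B.out q p.1 p.2 ++ W)
    have h2 := hc.1 q p.1 p.2
    rw [List.length_append] at h1
    rw [unwind, List.length_cons]
    linarith

theorem length_run_le {B : Bimachine A Q D} {c : ℕ} (hc : B.OutputBound c) (q : Q) (w : List A) :
    (B.run q w).length ≤ c * (w.length + 1) := by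
  simpa [run, length_scan] using length_unwind_le hc q (B.scan B.start w []) []

end Bimachine

/-! ### Uniformization of rational relations by one bimachine -/

/-- The states are the members of the union of all the families. The first pass does not depend on
`a`; only the starting state of the second does, so one bimachine serves every letter. -/
theorem exists_bimachine {A : Type*} {R : A → Set (FreeMonoid A × FreeMonoid A)} [Finite A]
    (hR : ∀ a, HasFiniteResiduals (R a)) :
    ∃ (m : ℕ) (B : Bimachine A (Fin m) (Set (Fin m))) (q : A → Fin m),
      ∀ a w v, (w, v) ∈ R a → (w, FreeMonoid.ofList (B.run (q a) w.toList)) ∈ R a := by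
  choose G hGf hRG hG using hR
  have hfin : (⋃ a, G a).Finite := Set.finite_iUnion hGf
  have hres := IsResidualFamily.iUnion hG
  obtain ⟨m, ⟨e⟩⟩ := hfin.to_subtype.exists_equiv_fin
  set rel : Fin m → Set (FreeMonoid A × FreeMonoid A) := fun q => (e.symm q).1 with hrel
  let good (q : Fin m) (a : A) (q' : Fin m) (x : FreeMonoid A) : Prop :=
    ∀ p ∈ rel q', (p.1 * FreeMonoid.of a, p.2 * x) ∈ rel q
  -- Choice makes the transitions total; the default `q, 1` is never used on a legal run.
  have hstep (q : Fin m) (a : A) (d : Set (Fin m)) :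
      ∃ q' x, (∃ q' ∈ d, ∃ x, good q a q' x) → q' ∈ d ∧ good q a q' x := by
    by_cases h : ∃ q' ∈ d, ∃ x, good q a q' x
    · obtain ⟨q', h1, x, h2⟩ := h
      exact ⟨q', x, fun _ => ⟨h1, h2⟩⟩
    · exact ⟨q, 1, fun h' => (h h').elim⟩
  choose tr ot hto using hstep
  have hlast (q : Fin m) : ∃ v, (∃ v, ((1 : FreeMonoid A), v) ∈ rel q) → (1, v) ∈ rel q := by
    by_cases h : ∃ v, ((1 : FreeMonoid A), v) ∈ rel q
    · exact ⟨h.choose, fun _ => h.choose_spec⟩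
    · exact ⟨1, fun h' => (h h').elim⟩
  choose fi hfi using hlast
  let B : Bimachine A (Fin m) (Set (Fin m)) :=
    { start := {q | ∃ v, (1, v) ∈ rel q}
      next := fun a d => {q | ∃ q' ∈ d, ∃ x, good q a q' x}
      trans := tr
      out := fun q a d => (ot q a d).toList
      fin := fun q => (fi q).toList }
  -- Completeness of the first pass, which is exactly the residual property.
  have hdom (w : List A) (q : Fin m) (v) (h : (FreeMonoid.ofList w, v) ∈ rel q) :
      q ∈ B.prefixState w := by
    induction w using List.reverseRecOn generalizing q v with
    | nil => exact ⟨v, h⟩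
    | append_singleton w a ih =>
      obtain ⟨g', h', x, hx, y, hy⟩ := hres _ (e.symm q).2 (FreeMonoid.ofList w) a v h
      rw [Bimachine.prefixState, List.foldl_append]
      have hg : rel (e ⟨g', h'⟩) = g' := by simp [hrel]
      exact ⟨e ⟨g', h'⟩, ih _ y (by rwa [hg]), x, fun p hp => hx p (by rwa [hg] at hp)⟩
  -- Soundness of the second pass: the chosen state stays in the recorded set, down to the empty
  -- word.
  have hsound (w : List A) (q : Fin m) (hq : q ∈ B.prefixState w) (W : List A) :
      ∃ v : FreeMonoid A, B.unwind q (B.scan B.start w []) W = v.toList ++ W ∧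
        (FreeMonoid.ofList w, v) ∈ rel q := by
    induction w using List.reverseRecOn generalizing q W with
    | nil => exact ⟨fi q, rfl, hfi q hq⟩
    | append_singleton w a ih =>
      rw [Bimachine.prefixState, List.foldl_append] at hq
      obtain ⟨h1, h2⟩ := hto q a (B.prefixState w) hq
      obtain ⟨v, hv, hv'⟩ := ih (tr q a (B.prefixState w)) h1
        ((ot q a (B.prefixState w)).toList ++ W)
      refine ⟨v * ot q a (B.prefixState w), ?_, h2 _ hv'⟩
      rw [B.scan_append_singleton]
      refine hv.trans ?_
      simp
  refine ⟨m, B, fun a => e ⟨R a, Set.mem_iUnion.2 ⟨a, hRG a⟩⟩, fun a w v h => ?_⟩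
  have hg : rel (e ⟨R a, Set.mem_iUnion.2 ⟨a, hRG a⟩⟩) = R a := by simp [hrel]
  obtain ⟨v', h1, h2⟩ := hsound w.toList _ (hdom w.toList _ v (hg.symm ▸ h)) []
  rw [hg] at h2
  rw [Bimachine.run, h1, List.append_nil]
  exact h2

/-! ### Simulation by a multi-stack Turing machine -/

namespace Turing.TM2

/-- The statement that pushes the word `l` on the stack `k`, with the first letter on top. -/
def Stmt.pushList {K Λ σ : Type*} {Γ : K → Type*} (k : K) :
    List (Γ k) → Stmt Γ Λ σ → Stmt Γ Λ σ
  | [], q => q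
  | x :: l, q => pushList k l (.push k (fun _ => x) q)

theorem stepAux_pushList {K Λ σ : Type*} {Γ : K → Type*} [DecidableEq K] (k : K)
    (l : List (Γ k)) (q : Stmt Γ Λ σ) (v : σ) (S : ∀ k, List (Γ k)) :
    stepAux (.pushList k l q) v S = stepAux q v (Function.update S k (l ++ S k)) := by
  induction l generalizing q with
  | nil => simp [Stmt.pushList]
  | cons x l ih => simp [Stmt.pushList, ih]

end Turing.TM2

theorem FreeSemigroup.toList_toFreeMonoid {A : Type*} (u : FreeSemigroup A) :
    u.toFreeMonoid.toList = u.head :: u.tail :=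
  congrArg FreeMonoid.toList (FreeSemigroup.toFreeMonoid_mk_eq_cons u.head u.tail)

namespace Bimachine

open Turing TM2.Stmt

/-- Labels of the machine that iterates a bimachine. -/
inductive Label (A Q D : Type) : Type
  | start
  | load (a : A)
  | next
  | scan (a : A) (d : D)
  | save (a : A) (d : D) (b : A)
  | unwind (q : Q)
  | emit (q : Q) (b : A) (d : D)
  | finish (q : Q)

theorem Label.finite (A Q D : Type) [Finite A] [Finite Q] [Finite D] : Finite (Label A Q D) := by
  let f : Label A Q D → Bool ⊕ A ⊕ (A × D) ⊕ (A × D × A) ⊕ Q ⊕ (Q × A × D) ⊕ Q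
    | .start => .inl true
    | .load a => .inr (.inl a)
    | .next => .inl false
    | .scan a d => .inr (.inr (.inl (a, d)))
    | .save a d b => .inr (.inr (.inr (.inl (a, d, b))))
    | .unwind q => .inr (.inr (.inr (.inr (.inl q))))
    | .emit q b d => .inr (.inr (.inr (.inr (.inr (.inl (q, b, d))))))
    | .finish q => .inr (.inr (.inr (.inr (.inr (.inr q)))))
  refine Finite.of_injective f fun x y h => ?_
  cases x <;> cases y <;> simp_all [f]

/-- Stack alphabets: `some false` is the input stack, `some true` the working stack and `none` the
stack that records the first pass. -/
abbrev StackAlphabet (A D : Type) : Option Bool → Type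
  | some _ => A
  | none => A × D

/-- The program that iterates a bimachine: the working stack is filled with `ini a` where `a` is the
first letter of the input, and each further letter `a` replaces its content `w` by
`B.run (q a) w`. -/
def program {A : Type*} {A' Q D : Type} (i : A ≃ A') (B : Bimachine A Q D) (ini : A → List A)
    (q : A → Q) : Label A' Q D →
      TM2.Stmt (StackAlphabet A' D) (Label A' Q D) (Option (A' ⊕ A' × D))
  | .start => pop (some false) (fun _ x => x.map .inl) <| goto fun
      | some (.inl a) => .load a
      | _ => .next
  | .load a => pushList (Γ := StackAlphabet A' D) (some true) ((ini (i.symm a)).map i) <|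
      goto fun _ => .next
  | .next => pop (some false) (fun _ x => x.map .inl) <| branch Option.isNone halt <| goto fun
      | some (.inl a) => .scan a B.start
      | _ => .start
  | .scan a d => pop (some true) (fun _ x => x.map .inl) <| goto fun
      | some (.inl b) => .save a d b
      | _ => .unwind (q (i.symm a))
  | .save a d b => push none (fun _ => (b, d)) <| goto fun _ => .scan a (B.next (i.symm b) d)
  | .unwind p => pop none (fun _ x => x.map .inr) <| goto fun
      | some (.inr (b, d)) => .emit p b d
      | _ => .finish p
  | .emit p b d => pushList (Γ := StackAlphabet A' D) (some true)
      ((B.out p (i.symm b) d).map i) <| goto fun _ => .unwind (B.trans p (i.symm b) d)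
  | .finish p => pushList (Γ := StackAlphabet A' D) (some true) ((B.fin p).map i) <|
      goto fun _ => .next

section Machine

variable {A : Type*} {A' Q D : Type} [Finite A'] [Finite Q] [Finite D] (i : A ≃ A')
  (B : Bimachine A Q D) (ini : A → List A) (q : A → Q)

/-- The Turing machine that iterates a bimachine. -/
noncomputable def machine : FinTM2 where
  K := Option Bool
  k₀ := some false
  k₁ := some true
  Γ := StackAlphabet A' D
  Λ := Label A' Q D
  main := .start
  ΛFin := @Fintype.ofFinite _ (Label.finite A' Q D)
  σ := Option (A' ⊕ A' × D)
  initialState := none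
  σFin := Fintype.ofFinite _
  Γk₀Fin := Fintype.ofFinite A'
  m := program i B ini q

/-- A configuration of the machine. -/
def config (l : Option (Label A' Q D)) (v : Option (A' ⊕ A' × D)) (U W : List A)
    (X : List (A × D)) : (machine i B ini q).Cfg where
  l := l
  var := v
  stk
    | some false => U.map i
    | some true => W.map i
    | none => X.map (Prod.map i id)

/-- The machine goes from `c` to `c'` in `n` steps. -/
def Runs (n : ℕ) (c c' : (machine i B ini q).Cfg) : Prop :=
  (flip bind (machine i B ini q).step)^[n] (some c) = some c'

variable {i B ini q}

theorem Runs.refl (c : (machine i B ini q).Cfg) : Runs i B ini q 0 c c := rfl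

theorem Runs.trans {m n : ℕ} {c c' c'' : (machine i B ini q).Cfg} (h : Runs i B ini q m c c')
    (h' : Runs i B ini q n c' c'') : Runs i B ini q (n + m) c c'' := by
  rw [Runs, Function.iterate_add_apply, h, h']

theorem Runs.head {n : ℕ} {c c' c'' : (machine i B ini q).Cfg}
    (h : (machine i B ini q).step c = some c') (h' : Runs i B ini q n c' c'') :
    Runs i B ini q (n + 1) c c'' :=
  Runs.trans (m := 1) h h'

/-- Comparing configurations one stack at a time lets most single steps be checked by `rfl`. -/
theorem config_congr {l l' : Option (Label A' Q D)} {v : Option (A' ⊕ A' × D)} {U W : List A}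
    {X : List (A × D)} {S : ∀ k, List (StackAlphabet A' D k)} (hl : l' = l)
    (h₀ : S (some false) = U.map i) (h₁ : S (some true) = W.map i)
    (h₂ : S none = X.map (Prod.map i id)) :
    some (TM2.Cfg.mk l' v S) = some (config i B ini q l v U W X) := by
  subst hl
  refine congrArg some (congrArg (TM2.Cfg.mk _ _) ?_)
  funext k
  rcases k with _ | _ | _
  exacts [h₂, h₀, h₁]

theorem step_start (v U W X) (a : A) :
    (machine i B ini q).step (config i B ini q (some .start) v (a :: U) W X) =
      some (config i B ini q (some (.load (i a))) (some (.inl (i a))) U W X) :=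
  config_congr rfl rfl rfl rfl

theorem step_load (v U W X) (a : A) :
    (machine i B ini q).step (config i B ini q (some (.load (i a))) v U W X) =
      some (config i B ini q (some .next) v U (ini a ++ W) X) := by
  refine (congrArg some (TM2.stepAux_pushList ..)).trans ?_
  refine config_congr rfl rfl ?_ rfl
  rw [Equiv.symm_apply_apply]
  exact List.map_append.symm

theorem step_next_nil (v W X) :
    (machine i B ini q).step (config i B ini q (some .next) v [] W X) =
      some (config i B ini q none none [] W X) :=
  config_congr rfl rfl rfl rfl

theorem step_next_cons (v U W X) (a : A) :
    (machine i B ini q).step (config i B ini q (some .next) v (a :: U) W X) =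
      some (config i B ini q (some (.scan (i a) B.start)) (some (.inl (i a))) U W X) :=
  config_congr rfl rfl rfl rfl

theorem step_scan_nil (v U X) (a : A) (d : D) :
    (machine i B ini q).step (config i B ini q (some (.scan (i a) d)) v U [] X) =
      some (config i B ini q (some (.unwind (q a))) none U [] X) :=
  config_congr (congrArg (fun a => some (Label.unwind (q a))) (i.symm_apply_apply a)) rfl rfl rfl

theorem step_scan_cons (v U W X) (a b : A) (d : D) :
    (machine i B ini q).step (config i B ini q (some (.scan (i a) d)) v U (b :: W) X) =
      some (config i B ini q (some (.save (i a) d (i b))) (some (.inl (i b))) U W X) :=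
  config_congr rfl rfl rfl rfl

theorem step_save (v U W X) (a b : A) (d : D) :
    (machine i B ini q).step (config i B ini q (some (.save (i a) d (i b))) v U W X) =
      some (config i B ini q (some (.scan (i a) (B.next b d))) v U W ((b, d) :: X)) :=
  config_congr (congrArg (fun b => some (Label.scan (i a) (B.next b d))) (i.symm_apply_apply b))
    rfl rfl rfl

theorem step_unwind_nil (v U W) (p : Q) :
    (machine i B ini q).step (config i B ini q (some (.unwind p)) v U W []) =
      some (config i B ini q (some (.finish p)) none U W []) :=
  config_congr rfl rfl rfl rfl

theorem step_unwind_cons (v U W X) (p : Q) (b : A) (d : D) :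
    (machine i B ini q).step (config i B ini q (some (.unwind p)) v U W ((b, d) :: X)) =
      some (config i B ini q (some (.emit p (i b) d)) (some (.inr (i b, d))) U W X) :=
  config_congr rfl rfl rfl rfl

theorem step_emit (v U W X) (p : Q) (b : A) (d : D) :
    (machine i B ini q).step (config i B ini q (some (.emit p (i b) d)) v U W X) =
      some (config i B ini q (some (.unwind (B.trans p b d))) v U (B.out p b d ++ W) X) := by
  refine (congrArg some (TM2.stepAux_pushList ..)).trans ?_
  refine config_congr (congrArg (fun b => some (Label.unwind (B.trans p b d)))
    (i.symm_apply_apply b)) rfl ?_ rfl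
  rw [Equiv.symm_apply_apply]
  exact List.map_append.symm

theorem step_finish (v U W X) (p : Q) :
    (machine i B ini q).step (config i B ini q (some (.finish p)) v U W X) =
      some (config i B ini q (some .next) v U (B.fin p ++ W) X) := by
  refine (congrArg some (TM2.stepAux_pushList ..)).trans ?_
  refine config_congr rfl rfl ?_ rfl
  exact List.map_append.symm

theorem runs_scan (v U W X) (a : A) (d : D) :
    Runs i B ini q (2 * W.length + 1) (config i B ini q (some (.scan (i a) d)) v U W X)
      (config i B ini q (some (.unwind (q a))) none U [] (B.scan d W X)) := by
  induction W generalizing v d X with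
  | nil => exact (Runs.refl _).head (step_scan_nil ..)
  | cons b W ih => exact ((ih _ _ _).head (step_save ..)).head (step_scan_cons ..)

theorem runs_unwind (v U W X) (p : Q) :
    ∃ v', Runs i B ini q (2 * X.length + 2) (config i B ini q (some (.unwind p)) v U W X)
      (config i B ini q (some .next) v' U (B.unwind p X W) []) := by
  induction X generalizing v p W with
  | nil => exact ⟨_, ((Runs.refl _).head (step_finish ..)).head (step_unwind_nil ..)⟩
  | cons x X ih =>
    obtain ⟨v', h⟩ := ih (some (.inr (i x.1, x.2))) (B.out p x.1 x.2 ++ W) (B.trans p x.1 x.2)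
    exact ⟨v', (h.head (step_emit ..)).head (step_unwind_cons ..)⟩

theorem runs_next (v U W) (a : A) :
    ∃ v', Runs i B ini q (4 * W.length + 4) (config i B ini q (some .next) v (a :: U) W [])
      (config i B ini q (some .next) v' U (B.run (q a) W) []) := by
  obtain ⟨v', h⟩ := runs_unwind (i := i) (B := B) (ini := ini) (q := q) none U []
    (B.scan B.start W []) (q a)
  refine ⟨v', ?_⟩
  rw [length_scan, List.length_nil] at h
  have := ((runs_scan ..).trans h).head (step_next_cons v U W [] a)
  rwa [show 2 * (W.length + 0) + 2 + (2 * W.length + 1) + 1 = 4 * W.length + 4 by ring] at this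

/-- The bound `n` varies so that induction can replace it by `(2c+1)n`, which stays positive even if
`c = 0`. The base `2c+2` has one unit to spare, which pays for the current pass of at most `8n`
steps. -/
theorem exists_runs_foldl {c : ℕ} (hc : B.OutputBound c) (v U W) {n : ℕ} (hn : 1 ≤ n)
    (hW : W.length ≤ n) :
    ∃ m ≤ 8 * n * (2 * c + 2) ^ (U.length + 1),
      Runs i B ini q m (config i B ini q (some .next) v U W [])
        (config i B ini q none none [] (U.foldl (fun w a => B.run (q a) w) W) []) := by
  induction U generalizing v W n with
  | nil =>
    refine ⟨1, ?_, (Runs.refl _).head (step_next_nil ..)⟩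
    have : 0 < 8 * n * (2 * c + 2) ^ (0 + 1) := by positivity
    exact this
  | cons a U ih =>
    obtain ⟨v', h⟩ := runs_next (i := i) (B := B) (ini := ini) (q := q) v U W a
    have hlen : (B.run (q a) W).length ≤ (2 * c + 1) * n := by
      have := length_run_le hc (q a) W
      nlinarith
    obtain ⟨m, hm, h'⟩ := ih v' _ (n := (2 * c + 1) * n) (Nat.mul_pos (by omega) hn) hlen
    refine ⟨m + (4 * W.length + 4), ?_, h.trans h'⟩
    have h1 : 1 ≤ (2 * c + 2) ^ (U.length + 1) := Nat.one_le_pow _ _ (by omega)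
    rw [List.length_cons, pow_succ _ (U.length + 1)]
    calc m + (4 * W.length + 4)
        ≤ 8 * ((2 * c + 1) * n) * (2 * c + 2) ^ (U.length + 1) +
            8 * n * (2 * c + 2) ^ (U.length + 1) := by
          refine Nat.add_le_add hm ?_
          calc 4 * W.length + 4 ≤ 8 * n * 1 := by omega
            _ ≤ _ := Nat.mul_le_mul_left _ h1
      _ = _ := by ring

end Machine

theorem length_foldl_run_le {A Q D : Type*} {B : Bimachine A Q D} {c : ℕ} (hc : B.OutputBound c)
    (q : A → Q) (U W : List A) {n : ℕ} (hn : 1 ≤ n) (hW : W.length ≤ n) :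
    (U.foldl (fun w a => B.run (q a) w) W).length ≤ n * (2 * c + 2) ^ U.length := by
  induction U generalizing W n with
  | nil => simpa using hW
  | cons a U ih =>
    have hlen : (B.run (q a) W).length ≤ n * (2 * c + 2) := by
      have := length_run_le hc (q a) W
      nlinarith
    have := ih _ (Nat.mul_pos hn (by omega)) hlen
    rw [List.length_cons, pow_succ']
    rwa [mul_assoc] at this

theorem isComputableInExponentialTime {A : Type*} {Q D : Type} [Finite A] [Finite Q] [Finite D]
    (B : Bimachine A Q D) (ini : A → List A) (q : A → Q) (f : FreeSemigroup A → FreeSemigroup A)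
    (hf : ∀ u, (f u).toFreeMonoid.toList = u.tail.foldl (fun w a => B.run (q a) w) (ini u.head)) :
    IsComputableInExponentialTime f := by
  obtain ⟨c, hc⟩ := B.exists_outputBound
  obtain ⟨c', hc'⟩ := (Set.finite_range fun a => (ini a).length).bddAbove
  -- The alphabet may live in any universe, while the machine needs stack alphabets in `Type`.
  obtain ⟨n, ⟨i⟩⟩ := Finite.exists_equiv_fin A
  -- The bound `c' + 1` makes the initial length bound positive; the extra `2` pays for the `start`
  -- and `load` steps.
  refine ⟨8 * (c' + 1) + 2, 2 * c + 2, machine i B ini q, i, i, ?_, fun u => ?_⟩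
  · rintro (_ | _)
    · exact inferInstanceAs (Finite (Fin n × D))
    · exact inferInstanceAs (Finite (Fin n))
  · obtain ⟨m, hm, h⟩ := exists_runs_foldl (i := i) (ini := ini) (q := q) hc
      (some (.inl (i u.head))) u.tail (ini u.head ++ []) (n := c' + 1) (by omega)
      (by simpa using (hc' ⟨u.head, rfl⟩ : (ini u.head).length ≤ c').trans (Nat.le_succ _))
    have h' := (h.head (step_load ..)).head (step_start none u.tail [] [] u.head)
    rw [List.append_nil, ← hf, ← FreeSemigroup.toList_toFreeMonoid] at h'
    have hinit (w : List A) : initList (machine i B ini q) (w.map i) =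
        config i B ini q (some .start) none w [] [] := by
      refine Option.some.inj (config_congr rfl ?_ ?_ ?_) <;> rfl
    have hhalt (w : List A) : haltList (machine i B ini q) (w.map i) =
        config i B ini q none none [] w [] := by
      refine Option.some.inj (config_congr rfl ?_ ?_ ?_) <;> rfl
    refine ⟨⟨⟨m + 1 + 1, ?_⟩, ?_⟩⟩
    · exact (congrArg (fun c => (flip bind (machine i B ini q).step)^[m + 1 + 1] (some c))
        (hinit _)).trans (Eq.trans h' (congrArg some (hhalt _).symm))
    · have h1 : 1 ≤ (2 * c + 2) ^ (u.tail.length + 1) := Nat.one_le_pow _ _ (by omega)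
      change m + 2 ≤ (8 * (c' + 1) + 2) * (2 * c + 2) ^ (u.tail.length + 1)
      linarith

end Bimachine

/-! ### Application to quasi-automatic structures -/

namespace QuasiAutomaticSemigroupStructure

variable {S : Type*} [Semigroup S] (Q : QuasiAutomaticSemigroupStructure S)

theorem exists_representative (s : S) : ∃ v ∈ Q.L, naturalHom Q.A v = s :=
  (Set.ext_iff.1 Q.image_L s).2 trivial

theorem exists_mem_Ra {v : FreeSemigroup Q.A} (hv : v ∈ Q.L) (a : Q.A) : ∃ v', (v, v') ∈ Q.Ra a := by
  obtain ⟨v', hv', h⟩ := Q.exists_representative (naturalHom Q.A (v * FreeSemigroup.of a))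
  exact ⟨v', by rw [Q.Ra_eq]; exact ⟨hv, hv', h.symm⟩⟩

theorem exists_bimachine : ∃ (m : ℕ) (B : Bimachine Q.A (Fin m) (Set (Fin m))) (q : Q.A → Fin m),
    ∀ a, ∀ v ∈ Q.L, ∃ v', (v, v') ∈ Q.Ra a ∧
      v'.toFreeMonoid.toList = B.run (q a) v.toFreeMonoid.toList := by
  have := Q.finite_A.to_subtype
  obtain ⟨m, B, q, h⟩ := _root_.exists_bimachine fun a => (Q.rational_Ra a).hasFiniteResiduals
  refine ⟨m, B, q, fun a v hv => ?_⟩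
  obtain ⟨v₀, hv₀⟩ := Q.exists_mem_Ra hv a
  obtain ⟨⟨v₁, v'⟩, h1, h2⟩ := h a _ _ ⟨_, hv₀, rfl⟩
  obtain ⟨h3, h4⟩ := Prod.mk.inj h2
  obtain rfl := FreeSemigroup.toFreeMonoid_injective h3
  exact ⟨v', h1, congrArg FreeMonoid.toList h4⟩

end QuasiAutomaticSemigroupStructure

theorem mainTheorem4 {S : Type*} [Semigroup S] (Q : QuasiAutomaticSemigroupStructure S) :
    ∃ l : FreeSemigroup Q.A → Q.L,
      (∀ u : FreeSemigroup Q.A, naturalHom Q.A (l u).1 = naturalHom Q.A u) ∧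
      (∀ (u : FreeSemigroup Q.A) (a : Q.A),
        naturalHom Q.A ((l u).1 * FreeSemigroup.of a) =
            naturalHom Q.A (l (u * FreeSemigroup.of a)).1 ∧
          ((l u).1, (l (u * FreeSemigroup.of a)).1) ∈ Q.Ra a) ∧
      (∃ N : ℕ, 1 < N ∧ ∀ u : FreeSemigroup Q.A, (l u).1.length ≤ N ^ u.length) ∧
      IsComputableInExponentialTime (fun u => (l u).1) := by
  have := Q.finite_A.to_subtype
  obtain ⟨m, B, q, hB⟩ := Q.exists_bimachine
  choose ini hiniL hini using fun a : Q.A => Q.exists_representative a.1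
  have hl (u : FreeSemigroup Q.A) : ∃ v ∈ Q.L, naturalHom Q.A v = naturalHom Q.A u ∧
      v.toFreeMonoid.toList =
        u.tail.foldl (fun w a => B.run (q a) w) (ini u.head).toFreeMonoid.toList := by
    obtain ⟨h, t⟩ := u
    induction t using List.reverseRecOn with
    | nil => exact ⟨ini h, hiniL h, hini h, rfl⟩
    | append_singleton t a ih =>
      obtain ⟨v, hv, h1, h2⟩ := ih
      obtain ⟨v', h3, h4⟩ := hB a v hv
      rw [Q.Ra_eq] at h3
      refine ⟨v', h3.2.1, ?_, ?_⟩
      · change _ = naturalHom Q.A (⟨h, t⟩ * FreeSemigroup.of a)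
        rw [← h3.2.2, map_mul, map_mul, h1]
      · rw [h4, h2, List.foldl_append]
        rfl
  choose l hlL hlhom hlw using hl
  -- `R_a` contains every pair in `L × L` with the right values, so no further property of the
  -- bimachine is needed.
  have hRa (u : FreeSemigroup Q.A) (a : Q.A) : (l u, l (u * FreeSemigroup.of a)) ∈ Q.Ra a := by
    rw [Q.Ra_eq]
    exact ⟨hlL _, hlL _, by rw [map_mul, hlhom, hlhom, map_mul]⟩
  refine ⟨fun u => ⟨l u, hlL u⟩, hlhom, fun u a => ⟨?_, hRa u a⟩, ?_,
    B.isComputableInExponentialTime (fun a => (ini a).toFreeMonoid.toList) q l hlw⟩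
  · rw [map_mul, hlhom, hlhom, map_mul]
  · obtain ⟨c, hc⟩ := B.exists_outputBound
    obtain ⟨c', hc'⟩ := (Set.finite_range fun a => (ini a).length).bddAbove
    -- This `N` dominates both the growth factor and the initial length: one factor `N` covers the
    -- first letter, the others the tail.
    refine ⟨2 * c + 2 + c', by omega, fun u => ?_⟩
    have h := Bimachine.length_foldl_run_le hc q u.tail (ini u.head).toFreeMonoid.toList
      (n := 2 * c + 2 + c') (by omega)
      (by
        rw [FreeSemigroup.toList_toFreeMonoid]
        exact (hc' ⟨u.head, rfl⟩ : (ini u.head).length ≤ c').trans (Nat.le_add_left _ _))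
    rw [← hlw, FreeSemigroup.toList_toFreeMonoid] at h
    change (l u).length ≤ _ ^ (u.tail.length + 1)
    rw [pow_succ']
    exact h.trans (Nat.mul_le_mul_left _ (Nat.pow_le_pow_left (Nat.le_add_right _ _) _))
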